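/- Let $n\ge 1$, let $\Omega\subset\mathbb R^n$ be a non-empty, open and bounded set, and let $1<p<\infty$. Let $$W(\xi,\zeta)=\mathrm{dist}_1^p\big((\xi,\zeta),K\big)=\Big(\min_{(\alpha,\beta)\in K}\big(|\xi-\alpha|+|\zeta-\beta|\big)\Big)^p,\qquad (\xi,\zeta)\in\mathbb R\times\mathbb R,$$ with $K=\{(1,0),(-1,0),(0,1),(0,-1)\}$. For $G:\mathbb R\times\mathbb R\to\mathbb R$ lower semicontinuous with $p$-growth, meaning that there is a constant $C>0$ with $G(\xi,\zeta)\le C(|\xi|^p+|\zeta|^p+1)$ for all $\xi,\zeta\in\mathbb R$, and for $u\in L^p(\Omega)$, put $$I_G(u)=\int_\Omega\int_\Omega G(u(x),u(y))\,dx\,dy\in[-\infty,\infty),$$ and let $$I_W^{\rm rlx}(u)=\inf\Big\{\liminf_{j\to\infty}I_W(u_j)\,:\,u_j\rightharpoonup u\text{ in }L^p(\Omega)\Big\}$$ be the relaxation of $I_W$ with respect to weak convergence in $L^p(\Omega)$. Then there exists no symmetric (that is, $G(\xi,\zeta)=G(\zeta,\xi)$ for all $\xi,\zeta\in\mathbb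 R$), lower semicontinuous function $G:\mathbb R\times\mathbb R\to\mathbb R$ with $p$-growth such that $I_W^{\rm rlx}(u)=I_G(u)$ for all $u\in L^p(\Omega)$. -/

import Mathlib

open MeasureTheory Filter Topology

noncomputable section

/-- The space `L^p(Ω) = L^p(Ω; ℝ)` for `Ω ⊆ ℝⁿ` with Lebesgue measure. -/
abbrev LpOn {n : ℕ} (p : ℝ) (Ω : Set (EuclideanSpace ℝ (Fin n))) : Type :=
  Lp ℝ (ENNReal.ofReal p) (volume.restrict Ω)

/-- Weak convergence of a sequence in `L^p(Ω)`, `1 < p < ∞`: convergence of the pairings with all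
functions in `L^{p'}(Ω)`, where `p' = p / (p - 1)`. -/
def WeaklyConverges {n : ℕ} {p : ℝ} {Ω : Set (EuclideanSpace ℝ (Fin n))}
    (v : ℕ → LpOn p Ω) (u : LpOn p Ω) : Prop :=
  ∀ g : LpOn p.conjExponent Ω,
    Tendsto (fun j => ∫ x in Ω, v j x * g x) atTop (𝓝 (∫ x in Ω, u x * g x))

/-- The integrand is symmetric. -/
def SymmetricIntegrand (G : ℝ × ℝ → ℝ) : Prop :=
  ∀ ξ ζ : ℝ, G (ξ, ζ) = G (ζ, ξ)

/-- The integrand has `p`-growth (a bound from above only). -/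
def HasPGrowth (p : ℝ) (G : ℝ × ℝ → ℝ) : Prop :=
  ∃ C : ℝ, 0 < C ∧ ∀ ξ ζ : ℝ, G (ξ, ζ) ≤ C * (|ξ| ^ p + |ζ| ^ p + 1)

/-- The double integral `I_G(u) = ∫_Ω ∫_Ω G(u(x), u(y)) dx dy`, as the integral of the positive
part minus the integral of the negative part, with values in the extended reals. If `Ω` is bounded
and `G` has `p`-growth, the first of these is finite for all `u ∈ L^p(Ω)`, so that the difference
is never of the form `∞ - ∞`. -/
def doubleIntegral {n : ℕ} {p : ℝ} {Ω : Set (EuclideanSpace ℝ (Fin n))}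
    (G : ℝ × ℝ → ℝ) (u : LpOn p Ω) : EReal :=
  ((∫⁻ y in Ω, ∫⁻ x in Ω, ENNReal.ofReal (G (u x, u y)) : ENNReal) : EReal)
    - ((∫⁻ y in Ω, ∫⁻ x in Ω, ENNReal.ofReal (-G (u x, u y)) : ENNReal) : EReal)

/-- The relaxation of a functional `I` with respect to weak convergence in `L^p(Ω)`:
`I^rlx(u) = inf { liminf_j I(u_j) : u_j ⇀ u in L^p(Ω) }`. -/
def weakRelaxation {n : ℕ} {p : ℝ} {Ω : Set (EuclideanSpace ℝ (Fin n))}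
    (I : LpOn p Ω → EReal) (u : LpOn p Ω) : EReal :=
  sInf {c : EReal | ∃ v : ℕ → LpOn p Ω,
    WeaklyConverges v u ∧ c = liminf (fun j => I (v j)) atTop}

/-- The four wells `K = {(±1, 0), (0, ±1)}`. -/
def fourWells : Set (ℝ × ℝ) :=
  {(1, 0), (-1, 0), (0, 1), (0, -1)}

/-- The distance of a point of `ℝ × ℝ` to a set, in the `1`-norm `‖(ξ, ζ)‖₁ = |ξ| + |ζ|`. -/
def dist₁ (z : ℝ × ℝ) (K : Set (ℝ × ℝ)) : ℝ :=
  Metric.infDist (WithLp.toLp 1 z) (WithLp.toLp 1 '' K)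

/-- The integrand `W(ξ, ζ) = dist₁^p((ξ, ζ), K)`. -/
def fourWellIntegrand (p : ℝ) (z : ℝ × ℝ) : ℝ :=
  dist₁ z fourWells ^ p

end

/-! `W` depends only on `|ξ|` and `|ζ|`, and the double integral depends only on the distribution of
values of `u`. Hence signs may be chosen freely: oscillating between `±|s|` realises, as weak
limits, all means up to the mean of `|s|`, at no cost in energy. Moreover, the values may be placed
anywhere in `Ω` provided that their total distribution is kept.

Suppose the relaxation is `I_G`, and put `M = |Ω|`, `Z = G (0, 0)`. Since signs can be arranged to
give mean zero, `M ^ 2 * Z` is the minimum of the relaxed functional. Let `e` be the largest `a ≥ 0`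
with `G (a, a) = Z`; it exists because `G` is lower semicontinuous and `W` grows superlinearly. Take
a nearly optimal distribution `P` whose mean of `|s|` is almost `e`. Its energy is at most `3/4`,
whereas a distribution with `|s|` nearly constant costs about `1`, as all wells are off the set `|ξ|
= |ζ|`. So a definite fraction of `P` has a mean of `|s|` exceeding `e` by a definite amount
(`exists_mass_above_mean`).

Put part of that fraction on a small set `A` and the rest of `P` on the complement. With suitable
signs the weak limit is `a > e` on `A` and `0` elsewhere, still at minimal relaxed energy
(`weakRelaxation_le_finiteEnergy_of_abs_le`). Then `I_G` of this function, a quadratic polynomial in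
`|A|`, equals `M ^ 2 * Z` for all small `|A|`. Comparing coefficients gives `G (a, a) = Z`, against
the maximality of `e`. -/

/-! ### The four-well integrand: symmetry, cost near the diagonals, growth -/

lemma dist₁_fourWells (x y : ℝ) :
    dist₁ (x, y) fourWells = min (|(|x| - 1)| + |y|) (|x| + |(|y| - 1)|) := by
  have hne : (WithLp.toLp 1 '' fourWells : Set (WithLp 1 (ℝ × ℝ))).Nonempty :=
    ⟨_, (1, 0), by simp [fourWells], rfl⟩
  have hle : ∀ w ∈ fourWells, dist₁ (x, y) fourWells ≤ |x - w.1| + |y - w.2| := by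
    intro w hw
    have := Metric.infDist_le_dist_of_mem (x := WithLp.toLp 1 (x, y))
      (Set.mem_image_of_mem (WithLp.toLp 1) hw)
    simpa [dist₁, WithLp.prod_dist_eq_of_L1, Real.dist_eq] using this
  apply le_antisymm
  · apply le_min
    · rcases le_total 0 x with h | h
      · simpa [abs_of_nonneg h] using hle (1, 0) (by simp [fourWells])
      · have := hle (-1, 0) (by simp [fourWells])
        rw [abs_of_nonpos h, ← abs_neg (-x - 1)]
        simpa [add_comm] using this
    · rcases le_total 0 y with h | h
      · simpa [abs_of_nonneg h] using hle (0, 1) (by simp [fourWells])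
      · have := hle (0, -1) (by simp [fourWells])
        rw [abs_of_nonpos h, ← abs_neg (-y - 1)]
        simpa [add_comm] using this
  · refine (Metric.le_infDist hne).2 ?_
    have key : ∀ z : ℝ, |(|z| - 1)| ≤ |z - 1| ∧ |(|z| - 1)| ≤ |z + 1| := fun z =>
      ⟨by simpa using abs_abs_sub_abs_le z 1,
        by simpa using abs_abs_sub_abs_le z (-1)⟩
    rintro _ ⟨w, hw, rfl⟩
    simp only [fourWells, Set.mem_insert_iff, Set.mem_singleton_iff] at hw
    rw [WithLp.prod_dist_eq_of_L1]
    rcases hw with rfl | rfl | rfl | rfl <;>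
      simp only [Real.dist_eq, WithLp.toLp_fst, WithLp.toLp_snd, sub_zero, sub_neg_eq_add]
    · exact (min_le_left _ _).trans (by linarith [(key x).1])
    · exact (min_le_left _ _).trans (by linarith [(key x).2])
    · exact (min_le_right _ _).trans (by linarith [(key y).1])
    · exact (min_le_right _ _).trans (by linarith [(key y).2])

lemma dist₁_nonneg (z : ℝ × ℝ) (K : Set (ℝ × ℝ)) : 0 ≤ dist₁ z K := Metric.infDist_nonneg

lemma dist₁_fourWells_congr {x y x' y' : ℝ} (hx : |x| = |x'|) (hy : |y| = |y'|) :
    dist₁ (x, y) fourWells = dist₁ (x', y') fourWells := by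
  simp only [dist₁_fourWells, hx, hy]

lemma one_sub_le_dist₁_fourWells (x y : ℝ) : 1 - |(|x| - |y|)| ≤ dist₁ (x, y) fourWells := by
  rw [dist₁_fourWells]
  apply le_min
  · linarith [neg_abs_le (|x| - 1), le_abs_self (|x| - |y|)]
  · linarith [neg_abs_le (|y| - 1), neg_abs_le (|x| - |y|)]

lemma abs_sub_one_le_dist₁_fourWells (x y : ℝ) : |x| - 1 ≤ dist₁ (x, y) fourWells := by
  rw [dist₁_fourWells]
  apply le_min
  · linarith [le_abs_self (|x| - 1), abs_nonneg y]
  · linarith [abs_nonneg (|y| - 1)]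

lemma dist₁_le_add (x y x' y' : ℝ) (K : Set (ℝ × ℝ)) :
    dist₁ (x, y) K ≤ dist₁ (x', y') K + (|x - x'| + |y - y'|) := by
  have := Metric.infDist_le_infDist_add_dist (s := (WithLp.toLp 1 '' K : Set (WithLp 1 (ℝ × ℝ))))
    (x := WithLp.toLp 1 (x, y)) (y := WithLp.toLp 1 (x', y'))
  simpa [dist₁, WithLp.prod_dist_eq_of_L1, Real.dist_eq] using this

lemma continuous_dist₁ (K : Set (ℝ × ℝ)) : Continuous fun z : ℝ × ℝ => dist₁ z K :=
  (Metric.continuous_infDist_pt _).comp (WithLp.prod_continuous_toLp 1 ℝ ℝ)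

lemma fourWellIntegrand_nonneg (p : ℝ) (z : ℝ × ℝ) : 0 ≤ fourWellIntegrand p z :=
  Real.rpow_nonneg (dist₁_nonneg _ _) _

lemma fourWellIntegrand_congr (p : ℝ) {x y x' y' : ℝ} (hx : |x| = |x'|) (hy : |y| = |y'|) :
    fourWellIntegrand p (x, y) = fourWellIntegrand p (x', y') := by
  simp only [fourWellIntegrand, dist₁_fourWells_congr hx hy]

/-- Points with `|x| = |y|` are at distance at least `1` from the wells; Bernoulli's inequality
makes this quantitative. It is what penalises concentration of `|s|`. -/
lemma one_sub_mul_le_fourWellIntegrand {p : ℝ} (hp : 1 ≤ p) (x y : ℝ) :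
    1 - p * |(|x| - |y|)| ≤ fourWellIntegrand p (x, y) := by
  rcases le_total 1 |(|x| - |y|)| with h | h
  · exact le_trans (by nlinarith) (fourWellIntegrand_nonneg p (x, y))
  · have h1 := one_add_mul_self_le_rpow_one_add (s := -|(|x| - |y|)|) (by linarith) hp
    have h2 := one_sub_le_dist₁_fourWells x y
    calc 1 - p * |(|x| - |y|)| = 1 + p * -|(|x| - |y|)| := by ring
      _ ≤ (1 + -|(|x| - |y|)|) ^ p := h1
      _ ≤ fourWellIntegrand p (x, y) :=
        Real.rpow_le_rpow (by linarith) (by linarith) (by linarith)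

/-- Superlinear growth of the four-well integrand in its first variable. -/
lemma exists_abs_le_fourWellIntegrand {p : ℝ} (hp : 1 < p) {η : ℝ} (hη : 0 < η) :
    ∃ C : ℝ, 0 < C ∧ ∀ x y : ℝ, |x| ≤ η * fourWellIntegrand p (x, y) + C := by
  have h1 : Tendsto (fun t : ℝ => t ^ (p - 1)) atTop atTop := tendsto_rpow_atTop (by linarith)
  obtain ⟨L, hL⟩ := eventually_atTop.1 (h1.eventually_ge_atTop (1 / η))
  set L' := max L 1
  refine ⟨L' + 1, by positivity, fun x y => ?_⟩
  have hW := fourWellIntegrand_nonneg p (x, y)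
  have hd := abs_sub_one_le_dist₁_fourWells x y
  set d := dist₁ (x, y) fourWells with hd_def
  have hdn : 0 ≤ d := dist₁_nonneg _ _
  rcases le_total d L' with h | h
  · nlinarith
  · have hd0 : 0 < d := lt_of_lt_of_le one_pos ((le_max_right L 1).trans h)
    have h2 : 1 / η ≤ d ^ (p - 1) := hL d ((le_max_left L 1).trans h)
    have h3 : fourWellIntegrand p (x, y) = d ^ (p - 1) * d := by
      rw [fourWellIntegrand, ← hd_def, ← Real.rpow_add_one hd0.ne']; ring_nf
    have h4 : d ≤ η * (d ^ (p - 1) * d) := by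
      have : 1 ≤ η * d ^ (p - 1) := by
        rw [div_le_iff₀ hη] at h2; linarith
      nlinarith
    rw [h3]
    have : 0 < L' := by positivity
    linarith

/-! ### Oscillating functions and labellings -/

lemma tendsto_integral_norm_translate_sub {E : Type*} [NormedAddCommGroup E] [NormedSpace ℝ E]
    [FiniteDimensional ℝ E] [MeasurableSpace E] [BorelSpace E] {ν : Measure E}
    [ν.IsAddHaarMeasure] {g : E → ℝ} (hg : Integrable g ν) :
    Tendsto (fun h : E => ∫ x, ‖g (x + h) - g x‖ ∂ν) (𝓝 0) (𝓝 0) := by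
  let c : E → C(E, E) := fun h => ⟨fun x => x + h, by fun_prop⟩
  have hc : Continuous c :=
    ContinuousMap.continuous_of_continuous_uncurry _ (by simp [c]; fun_prop)
  have hm : ∀ h, MeasurePreserving (c h) ν ν := fun h => measurePreserving_add_right ν h
  have hcont := (continuous_const (y := hg.toL1 g)).compMeasurePreservingLp hc hm ENNReal.one_ne_top
  have hnorm : ∀ h, ∫ x, ‖g (x + h) - g x‖ ∂ν =
      ‖Lp.compMeasurePreserving (c h) (hm h) (hg.toL1 g) - hg.toL1 g‖ := by
    intro h
    rw [L1.norm_eq_integral_norm]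
    apply integral_congr_ae
    filter_upwards [Lp.coeFn_sub (Lp.compMeasurePreserving (c h) (hm h) (hg.toL1 g)) (hg.toL1 g),
      Lp.coeFn_compMeasurePreserving (hg.toL1 g) (hm h), hg.coeFn_toL1,
      (hm h).quasiMeasurePreserving.ae_eq_comp hg.coeFn_toL1] with x h1 h2 h3 h4
    rw [h1, Pi.sub_apply, h2, h3, h4]
    rfl
  simp only [hnorm]
  have h0 : Lp.compMeasurePreserving (c 0) (hm 0) (hg.toL1 g) = hg.toL1 g := by
    apply Lp.ext
    filter_upwards [Lp.coeFn_compMeasurePreserving (hg.toL1 g) (hm 0)] with x h1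
    rw [h1]; simp [c]
  have := ((hcont.tendsto 0).sub_const (hg.toL1 g)).norm
  simpa only [h0, sub_self, norm_zero] using this

/-- Weak-* convergence of `x ↦ H (j ℓ(x))`, with `H` periodic, to the mean of `H`. -/
lemma tendsto_integral_periodic_comp_mul {E : Type*} [NormedAddCommGroup E] [NormedSpace ℝ E]
    [FiniteDimensional ℝ E] [MeasurableSpace E] [BorelSpace E] {ν : Measure E}
    [ν.IsAddHaarMeasure] (ℓ : E →L[ℝ] ℝ) {e : E} (he : ℓ e = 1) {H : ℝ → ℝ} (hH : Measurable H)
    (hper : Function.Periodic H 1) (hbd : ∀ t, |H t| ≤ 1) {g : E → ℝ} (hg : Integrable g ν) :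
    Tendsto (fun j : ℕ => ∫ x, H (j * ℓ x) * g x ∂ν) atTop
      (𝓝 ((∫ t in (0 : ℝ)..1, H t) * ∫ x, g x ∂ν)) := by
  have hT := tendsto_integral_norm_translate_sub hg
  rw [Metric.tendsto_atTop]
  intro ε hε
  obtain ⟨r, hr, hδ⟩ := Metric.eventually_nhds_iff.1 (hT.eventually_lt_const (half_pos hε))
  obtain ⟨N, hN⟩ := exists_nat_gt (‖e‖ / r)
  refine ⟨N + 1, fun j hj => ?_⟩
  have hjN : (N : ℝ) + 1 ≤ j := by exact_mod_cast hj
  have hj0 : (0 : ℝ) < j := by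
    have : (0 : ℝ) ≤ N := Nat.cast_nonneg N
    linarith
  -- `Y s` is the integral with the phase shifted by `s`. Its average over a period is exactly the
  -- claimed limit, and each `Y s` is close to `Y 0`.
  set Y : ℝ → ℝ := fun s => ∫ x, H (j * ℓ x + s) * g x ∂ν with hY
  have hint : Integrable (fun z : ℝ × E => H (j * ℓ z.2 + z.1) * g z.2)
      ((volume.restrict (Set.Ioc (0 : ℝ) 1)).prod ν) := by
    refine Integrable.bdd_mul (c := 1) (hg.comp_snd _) ?_ ?_
    · exact (hH.comp (by fun_prop)).aestronglyMeasurable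
    · exact ae_of_all _ fun z => hbd _
  have hYint : IntervalIntegrable Y volume 0 1 :=
    (intervalIntegrable_iff_integrableOn_Ioc_of_le zero_le_one).2 hint.integral_prod_left
  have hYval : ∫ s in (0 : ℝ)..1, Y s = (∫ t in (0 : ℝ)..1, H t) * ∫ x, g x ∂ν := by
    rw [intervalIntegral.integral_of_le zero_le_one, hY, integral_integral_swap hint,
      ← integral_const_mul]
    refine integral_congr_ae (ae_of_all _ fun x => ?_)
    simp only
    rw [integral_mul_const, ← intervalIntegral.integral_of_le zero_le_one,
      intervalIntegral.integral_comp_add_left (fun t => H t)]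
    have := hper.intervalIntegral_add_eq (j * ℓ x) 0
    simp only [zero_add] at this
    simp [this]
  have hclose : ∀ s ∈ Set.uIoc (0 : ℝ) 1,
      ‖(∫ x, H (j * ℓ x) * g x ∂ν) - Y s‖ ≤ ε / 2 := by
    intro s hs
    rw [Set.uIoc_of_le zero_le_one] at hs
    -- Translating by `(s / j) • e` trades the phase shift for a small translation of `g`, which is
    -- controlled in `L¹`.
    have h1 : ∫ x, H (j * ℓ x) * g x ∂ν = ∫ x, H (j * ℓ x + s) * g (x + (s / j) • e) ∂ν := by
      rw [← integral_add_right_eq_self _ ((s / j : ℝ) • e)]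
      refine integral_congr_ae (ae_of_all _ fun x => ?_)
      simp only [map_add, map_smul, he, smul_eq_mul, mul_one, mul_add, mul_div_cancel₀ s hj0.ne']
    have hm : AEStronglyMeasurable (fun x => H (j * ℓ x + s)) ν :=
      (hH.comp (by fun_prop)).aestronglyMeasurable
    have hgt : Integrable (fun x => g (x + (s / j : ℝ) • e)) ν := hg.comp_add_right _
    rw [h1, hY, ← integral_sub (hgt.bdd_mul (c := 1) hm (ae_of_all _ fun z => hbd _))
      (hg.bdd_mul (c := 1) hm (ae_of_all _ fun z => hbd _))]
    refine (norm_integral_le_integral_norm _).trans (le_trans ?_ (hδ (y := (s / j : ℝ) • e) ?_).le)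
    · refine integral_mono_of_nonneg (ae_of_all _ fun _ => norm_nonneg _) (hgt.sub hg).norm
        (ae_of_all _ fun x => ?_)
      simp only
      rw [← mul_sub, norm_mul]
      exact mul_le_of_le_one_left (norm_nonneg _) (hbd _)
    · rw [dist_zero_right, norm_smul, Real.norm_eq_abs, abs_of_nonneg (div_nonneg hs.1.le hj0.le)]
      rw [div_lt_iff₀ hr] at hN
      rw [div_mul_eq_mul_div, div_lt_iff₀ hj0]
      nlinarith [hs.2, hs.1, norm_nonneg e]
  rw [Real.dist_eq, ← hYval]
  have h2 : (∫ x, H (j * ℓ x) * g x ∂ν) - ∫ s in (0 : ℝ)..1, Y s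
      = ∫ s in (0 : ℝ)..1, ((∫ x, H (j * ℓ x) * g x ∂ν) - Y s) := by
    rw [intervalIntegral.integral_sub (by simp) hYint]
    simp
  rw [h2, ← Real.norm_eq_abs]
  have := intervalIntegral.norm_integral_le_of_norm_le_const hclose
  simp only [sub_zero, abs_one, mul_one] at this
  linarith

/-- Existence of labellings of `ℝⁿ` by a finite type that oscillate with prescribed volume
fractions. -/
lemma exists_oscillating_labels {n : ℕ} (hn : 1 ≤ n) {ι : Type} [Fintype ι] [MeasurableSpace ι]
    [MeasurableSingletonClass ι] {P : ι → ℝ} (hP : ∀ i, 0 ≤ P i) (hP1 : ∑ i, P i = 1) :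
    ∃ κ : ℕ → EuclideanSpace ℝ (Fin n) → ι, (∀ j, Measurable (κ j)) ∧
      ∀ i, ∀ g : EuclideanSpace ℝ (Fin n) → ℝ, Integrable g →
        Tendsto (fun j => ∫ x, (κ j ⁻¹' {i}).indicator g x) atTop (𝓝 (P i * ∫ x, g x)) := by
  classical
  let ρ : Measure ι := ∑ i, ENNReal.ofReal (P i) • Measure.dirac i
  have hρ : ∀ i, ρ {i} = ENNReal.ofReal (P i) := by
    intro i
    simp only [ρ, Measure.finsetSum_apply, Measure.smul_apply, smul_eq_mul,
      Measure.dirac_apply' _ (measurableSet_singleton i)]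
    rw [Finset.sum_eq_single i]
    · simp
    · intro b _ hb; simp [hb]
    · simp
  have : IsProbabilityMeasure ρ := ⟨by
    simp only [ρ, Measure.finsetSum_apply, Measure.smul_apply, smul_eq_mul, measure_univ, mul_one]
    rw [← ENNReal.ofReal_sum_of_nonneg (fun i _ => hP i), hP1, ENNReal.ofReal_one]⟩
  have : Nonempty ι := by
    by_contra h
    rw [not_nonempty_iff] at h
    simp at hP1
  -- `ψ` splits the unit interval into pieces of length `P i`; `Ψ` is its periodic extension,
  -- applied to the first coordinate, which exists as `n ≥ 1`.
  obtain ⟨ψ, hψ, hψρ⟩ := ρ.exists_measurable_map_eq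
  let Ψ : ℝ → ι := fun t => ψ (Set.projIcc 0 1 zero_le_one (Int.fract t))
  have hΨ : Measurable Ψ := hψ.comp (continuous_projIcc.measurable.comp measurable_fract)
  let ℓ : EuclideanSpace ℝ (Fin n) →L[ℝ] ℝ := EuclideanSpace.proj ⟨0, hn⟩
  refine ⟨fun j x => Ψ (j * ℓ x), fun j => hΨ.comp (by fun_prop), fun i g hg => ?_⟩
  let H : ℝ → ℝ := (Ψ ⁻¹' {i}).indicator 1
  have hHm : MeasurableSet (Ψ ⁻¹' {i}) := hΨ (measurableSet_singleton i)
  have hmean : ∫ t in (0 : ℝ)..1, H t = P i := by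
    -- Only almost everywhere: `Int.fract` sends the endpoint `1` to `0`.
    have h1 : ∀ᵐ t ∂volume.restrict (Set.Icc (0 : ℝ) 1), H t =
        (ψ ∘ Set.projIcc 0 1 zero_le_one ⁻¹' {i}).indicator 1 t := by
      rw [← restrict_Ico_eq_restrict_Icc]
      filter_upwards [ae_restrict_mem measurableSet_Ico] with t ht
      simp only [H, Ψ, Set.indicator, Set.mem_preimage, Function.comp, Int.fract_eq_self.2 ht]
    rw [intervalIntegral.integral_of_le zero_le_one, ← integral_Icc_eq_integral_Ioc,
      integral_congr_ae h1, ← integral_subtype_comap measurableSet_Icc]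
    have h2 : ∀ t : Set.Icc (0 : ℝ) 1,
        (ψ ∘ Set.projIcc 0 1 zero_le_one ⁻¹' {i}).indicator (1 : ℝ → ℝ) t
          = (ψ ⁻¹' {i}).indicator (1 : Set.Icc (0 : ℝ) 1 → ℝ) t := by
      intro t
      simp [Set.indicator, Set.projIcc_val]
    simp only [h2]
    rw [integral_indicator_one (hψ (measurableSet_singleton i))]
    have h3 : (volume : Measure (Set.Icc (0:ℝ) 1)) (ψ ⁻¹' {i}) = ENNReal.ofReal (P i) := by
      rw [← hρ i, ← hψρ, Measure.map_apply hψ (measurableSet_singleton i)]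
    change ((volume : Measure (Set.Icc (0:ℝ) 1)) (ψ ⁻¹' {i})).toReal = P i
    rw [h3, ENNReal.toReal_ofReal (hP i)]
  have hosc := tendsto_integral_periodic_comp_mul (ν := volume) ℓ
    (e := EuclideanSpace.single ⟨0, hn⟩ 1) (by simp [ℓ]) (H := H) (measurable_one.indicator hHm)
    (fun t => by simp [H, Ψ, Set.indicator])
    (fun t => by simp only [H, Set.indicator]; split_ifs <;> simp) hg
  rw [hmean] at hosc
  refine hosc.congr fun j => integral_congr_ae (ae_of_all _ fun x => ?_)
  simp [H, Set.indicator]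

/-! ### Energies of finitely valued functions and upper bounds for the relaxation -/

/-- The double integral of a function taking the finitely many values `s i`, each on a set of
measure `m i`. -/
def finiteEnergy {ι : Type} [Fintype ι] (G : ℝ × ℝ → ℝ) (s m : ι → ℝ) : ℝ :=
  ∑ i, ∑ k, m i * m k * G (s i, s k)

lemma lintegral_lintegral_ofReal_of_labels {E ι : Type} [MeasurableSpace E] {μ : Measure E}
    [IsFiniteMeasure μ] [Fintype ι] [MeasurableSpace ι] [MeasurableSingletonClass ι]
    (F : ℝ × ℝ → ℝ) (hF : ∀ z, 0 ≤ F z) {u : E → ℝ} {κ : E → ι} (hκ : Measurable κ) (s : ι → ℝ)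
    (hu : u =ᵐ[μ] fun x => s (κ x)) :
    ∫⁻ y, ∫⁻ x, ENNReal.ofReal (F (u x, u y)) ∂μ ∂μ =
      ENNReal.ofReal (finiteEnergy F s fun i => μ.real (κ ⁻¹' {i})) := by
  have hsum : ∀ f : ι → ENNReal, ∫⁻ x, f (κ x) ∂μ = ∑ i, f i * μ (κ ⁻¹' {i}) := by
    intro f
    rw [← lintegral_map (measurable_of_finite f) hκ, lintegral_fintype]
    simp only [Measure.map_apply hκ (measurableSet_singleton _)]
  have hin : ∀ t, ∫⁻ x, ENNReal.ofReal (F (u x, t)) ∂μ =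
      ∑ i, ENNReal.ofReal (F (s i, t)) * μ (κ ⁻¹' {i}) := by
    intro t
    rw [← hsum fun i => ENNReal.ofReal (F (s i, t))]
    exact lintegral_congr_ae (hu.mono fun x hx => by simp only [hx])
  simp only [hin]
  have hout : ∫⁻ y, ∑ i, ENNReal.ofReal (F (s i, u y)) * μ (κ ⁻¹' {i}) ∂μ =
      ∫⁻ y, ∑ i, ENNReal.ofReal (F (s i, s (κ y))) * μ (κ ⁻¹' {i}) ∂μ :=
    lintegral_congr_ae (hu.mono fun x hx => by simp only [hx])
  rw [hout, hsum fun k => ∑ i, ENNReal.ofReal (F (s i, s k)) * μ (κ ⁻¹' {i}), finiteEnergy,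
    Finset.sum_comm, ENNReal.ofReal_sum_of_nonneg fun k _ => Finset.sum_nonneg fun i _ =>
      mul_nonneg (mul_nonneg measureReal_nonneg measureReal_nonneg) (hF _)]
  refine Finset.sum_congr rfl fun k _ => ?_
  rw [ENNReal.ofReal_sum_of_nonneg fun i _ =>
      mul_nonneg (mul_nonneg measureReal_nonneg measureReal_nonneg) (hF _), Finset.sum_mul]
  refine Finset.sum_congr rfl fun i _ => ?_
  rw [ENNReal.ofReal_mul (mul_nonneg measureReal_nonneg measureReal_nonneg),
    ENNReal.ofReal_mul measureReal_nonneg, ofReal_measureReal, ofReal_measureReal]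
  ring

lemma doubleIntegral_of_labels {n : ℕ} {p : ℝ} {Ω : Set (EuclideanSpace ℝ (Fin n))}
    (hΩ : volume Ω ≠ ⊤) {ι : Type} [Fintype ι] [MeasurableSpace ι] [MeasurableSingletonClass ι]
    (G : ℝ × ℝ → ℝ) (u : LpOn p Ω) {κ : EuclideanSpace ℝ (Fin n) → ι} (hκ : Measurable κ)
    (s : ι → ℝ) (hu : u =ᵐ[volume.restrict Ω] fun x => s (κ x)) :
    doubleIntegral G u =
      ((finiteEnergy G s fun i => (volume.restrict Ω).real (κ ⁻¹' {i}) : ℝ) : EReal) := by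
  have : IsFiniteMeasure (volume.restrict Ω) := ⟨by simpa using hΩ.lt_top⟩
  have h1 := lintegral_lintegral_ofReal_of_labels (fun z => max (G z) 0)
    (fun z => le_max_right _ _) hκ s hu
  have h2 := lintegral_lintegral_ofReal_of_labels (fun z => max (-G z) 0)
    (fun z => le_max_right _ _) hκ s hu
  simp only [ENNReal.ofReal_max, ENNReal.ofReal_zero, zero_le, sup_of_le_left] at h1 h2
  have hnn : ∀ F : ℝ × ℝ → ℝ, (∀ z, 0 ≤ F z) →
      0 ≤ finiteEnergy F s fun i => (volume.restrict Ω).real (κ ⁻¹' {i}) := fun F hF =>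
    Finset.sum_nonneg fun i _ => Finset.sum_nonneg fun k _ =>
      mul_nonneg (mul_nonneg measureReal_nonneg measureReal_nonneg) (hF _)
  rw [doubleIntegral, h1, h2, EReal.coe_ennreal_ofReal, EReal.coe_ennreal_ofReal,
    max_eq_left (hnn _ fun z => le_max_right _ _), max_eq_left (hnn _ fun z => le_max_right _ _),
    ← EReal.coe_sub]
  congr 1
  simp only [finiteEnergy, ← Finset.sum_sub_distrib, ← mul_sub]
  refine Finset.sum_congr rfl fun i _ => Finset.sum_congr rfl fun k _ => ?_
  congr 1
  rcases le_total 0 (G (s i, s k)) with h | h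
  · rw [max_eq_left h, max_eq_right (by linarith)]; ring
  · rw [max_eq_right h, max_eq_left (by linarith)]; ring

/-- Labellings that oscillate with volume fractions `P` on `A` and `R` on the complement. -/
lemma exists_oscillating_labels_piecewise {n : ℕ} (hn : 1 ≤ n) {ι : Type} [Fintype ι]
    [MeasurableSpace ι] [MeasurableSingletonClass ι] {P R : ι → ℝ} (hP : ∀ i, 0 ≤ P i)
    (hP1 : ∑ i, P i = 1) (hR : ∀ i, 0 ≤ R i) (hR1 : ∑ i, R i = 1)
    {A : Set (EuclideanSpace ℝ (Fin n))} (hA : MeasurableSet A) :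
    ∃ κ : ℕ → EuclideanSpace ℝ (Fin n) → ι, (∀ j, Measurable (κ j)) ∧
      ∀ i, ∀ g : EuclideanSpace ℝ (Fin n) → ℝ, Integrable g →
        Tendsto (fun j => ∫ x in κ j ⁻¹' {i}, g x) atTop
          (𝓝 (P i * (∫ x in A, g x) + R i * ∫ x in Aᶜ, g x)) := by
  classical
  obtain ⟨κ₁, hm₁, h₁⟩ := exists_oscillating_labels hn hP hP1
  obtain ⟨κ₂, hm₂, h₂⟩ := exists_oscillating_labels hn hR hR1
  have hm : ∀ j, Measurable fun x => if x ∈ A then κ₁ j x else κ₂ j x :=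
    fun j => Measurable.ite hA (hm₁ j) (hm₂ j)
  refine ⟨fun j x => if x ∈ A then κ₁ j x else κ₂ j x, hm, fun i g hg => ?_⟩
  have ht := (h₁ i _ (hg.indicator hA)).add (h₂ i _ (hg.indicator hA.compl))
  rw [integral_indicator hA, integral_indicator hA.compl] at ht
  refine ht.congr fun j => ?_
  have hi : MeasurableSet ({i} : Set ι) := measurableSet_singleton i
  rw [← integral_add (((hg.indicator hA)).indicator (hm₁ j hi))
    (((hg.indicator hA.compl)).indicator (hm₂ j hi)),
    ← integral_indicator (hm j hi)]
  refine integral_congr_ae (ae_of_all _ fun x => ?_)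
  by_cases hx : x ∈ A <;> simp [Set.indicator, hx]

/-- The recovery sequence is `s ∘ κ j` for oscillating labels `κ j`. Its weak limit sees the means
of `s` under `P` and `R` separately, but its energy sees only the total volume of each label. -/
theorem weakRelaxation_le_finiteEnergy {n : ℕ} (hn : 1 ≤ n) {p : ℝ} (hp : 1 < p)
    {Ω : Set (EuclideanSpace ℝ (Fin n))} (hΩm : MeasurableSet Ω) (hΩ : volume Ω ≠ ⊤)
    (G : ℝ × ℝ → ℝ) {ι : Type} [Fintype ι] {P R : ι → ℝ} (hP : ∀ i, 0 ≤ P i)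
    (hP1 : ∑ i, P i = 1) (hR : ∀ i, 0 ≤ R i) (hR1 : ∑ i, R i = 1) (s : ι → ℝ)
    {A : Set (EuclideanSpace ℝ (Fin n))} (hA : MeasurableSet A) (u : LpOn p Ω)
    (huA : ∀ᵐ x ∂volume.restrict Ω, x ∈ A → u x = ∑ i, P i * s i)
    (huA' : ∀ᵐ x ∂volume.restrict Ω, x ∉ A → u x = ∑ i, R i * s i) :
    weakRelaxation (doubleIntegral G) u ≤
      ((finiteEnergy G s fun i => P i * (volume.restrict Ω).real A +
        R i * (volume.restrict Ω).real Aᶜ : ℝ) : EReal) := by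
  have : IsFiniteMeasure (volume.restrict Ω) := ⟨by simpa using hΩ.lt_top⟩
  let _ : MeasurableSpace ι := ⊤
  obtain ⟨κ, hκ, hlim⟩ := exists_oscillating_labels_piecewise hn hP hP1 hR hR1 hA
  have hsm : ∀ j, Measurable fun x => s (κ j x) := fun j => measurable_from_top.comp (hκ j)
  have hmem : ∀ j, MemLp (fun x => s (κ j x)) (ENNReal.ofReal p) (volume.restrict Ω) := fun j =>
    MemLp.of_bound (hsm j).aestronglyMeasurable (∑ i, |s i|) (ae_of_all _ fun x =>
      Finset.single_le_sum (f := fun i => |s i|) (fun i _ => abs_nonneg _)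
        (Finset.mem_univ (κ j x)))
  let v : ℕ → LpOn p Ω := fun j => (hmem j).toLp _
  have hv : ∀ j, v j =ᵐ[volume.restrict Ω] fun x => s (κ j x) := fun j => (hmem j).coeFn_toLp
  have hset : ∀ j i, MeasurableSet (κ j ⁻¹' {i}) := fun j i => hκ j (measurableSet_singleton i)
  have hlim' : ∀ i, ∀ g : EuclideanSpace ℝ (Fin n) → ℝ, Integrable g (volume.restrict Ω) →
      Tendsto (fun j => ∫ x in κ j ⁻¹' {i}, g x ∂volume.restrict Ω) atTop
        (𝓝 (P i * (∫ x in A, g x ∂volume.restrict Ω) +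
          R i * ∫ x in Aᶜ, g x ∂volume.restrict Ω)) := by
    intro i g hg
    have hB : ∀ B : Set (EuclideanSpace ℝ (Fin n)), MeasurableSet B →
        ∫ x in B, g x ∂volume.restrict Ω = ∫ x in B, Ω.indicator g x := by
      intro B hB
      rw [Measure.restrict_restrict hB, setIntegral_indicator hΩm]
    rw [hB A hA, hB Aᶜ hA.compl]
    simp only [hB _ (hset _ i)]
    exact hlim i _ ((integrable_indicator_iff hΩm).2 hg)
  refine sInf_le ⟨v, fun g => ?_, ?_⟩
  · have hp' : 1 < p.conjExponent := by
      rw [Real.conjExponent, lt_div_iff₀ (by linarith)]; linarith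
    have hg : Integrable g (volume.restrict Ω) :=
      (Lp.memLp g).integrable (by simpa using hp'.le)
    have hvj : ∀ j, ∑ i, s i * ∫ x in κ j ⁻¹' {i}, g x ∂volume.restrict Ω =
        ∫ x in Ω, v j x * g x := by
      intro j
      simp only [← integral_indicator (hset j _), ← integral_const_mul]
      rw [← integral_finsetSum _ fun i _ => ((hg.indicator (hset j i)).const_mul _)]
      refine integral_congr_ae ((hv j).mono fun x hx => ?_)
      simp only [hx]
      rw [Finset.sum_eq_single (κ j x)]
      · simp [Set.indicator]
      · intro b _ hb; simp [Set.indicator, hb.symm]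
      · simp
    have hu : ∑ i, s i * (P i * (∫ x in A, g x ∂volume.restrict Ω) +
        R i * ∫ x in Aᶜ, g x ∂volume.restrict Ω) = ∫ x in Ω, u x * g x := by
      have h1 : ∫ x in Ω, u x * g x = ∫ x in Ω, (A.indicator (fun x => (∑ i, P i * s i) * g x) x +
          Aᶜ.indicator (fun x => (∑ i, R i * s i) * g x) x) := by
        refine integral_congr_ae ?_
        filter_upwards [huA, huA'] with x h h'
        by_cases hx : x ∈ A
        · simp [hx, h hx]
        · simp [hx, h' hx]
      rw [h1, integral_add ((hg.const_mul _).indicator hA) ((hg.const_mul _).indicator hA.compl),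
        integral_indicator hA, integral_indicator hA.compl, integral_const_mul, integral_const_mul,
        Finset.sum_mul, Finset.sum_mul, ← Finset.sum_add_distrib]
      exact Finset.sum_congr rfl fun i _ => by ring
    rw [← hu]
    exact (tendsto_finsetSum _ fun i _ => (hlim' i g hg).const_mul (s i)).congr hvj
  · have hm : ∀ i, Tendsto (fun j => (volume.restrict Ω).real (κ j ⁻¹' {i})) atTop
        (𝓝 (P i * (volume.restrict Ω).real A + R i * (volume.restrict Ω).real Aᶜ)) := by
      intro i
      simpa [Measure.real] using hlim' i (fun _ => 1) (integrable_const _)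
    have hE : Tendsto (fun j => finiteEnergy G s fun i => (volume.restrict Ω).real (κ j ⁻¹' {i}))
        atTop (𝓝 (finiteEnergy G s fun i => P i * (volume.restrict Ω).real A +
          R i * (volume.restrict Ω).real Aᶜ)) :=
      tendsto_finsetSum _ fun i _ => tendsto_finsetSum _ fun k _ =>
        ((hm i).mul (hm k)).mul_const _
    have hE' := (continuous_coe_real_ereal.tendsto _).comp hE
    rw [← hE'.liminf_eq]
    congr 1
    funext j
    exact (doubleIntegral_of_labels hΩ G (v j) (hκ j) s (hv j)).symm

/-! ### Lower bounds: approximation by finitely valued functions -/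

lemma doubleIntegral_fourWellIntegrand {n : ℕ} {p : ℝ} {Ω : Set (EuclideanSpace ℝ (Fin n))}
    (u : LpOn p Ω) : doubleIntegral (fourWellIntegrand p) u =
      ((∫⁻ y in Ω, ∫⁻ x in Ω, ENNReal.ofReal (fourWellIntegrand p (u x, u y)) : ENNReal) : EReal) := by
  have : ∀ z, ENNReal.ofReal (-fourWellIntegrand p z) = 0 := fun z =>
    ENNReal.ofReal_of_nonpos (neg_nonpos.2 (fourWellIntegrand_nonneg p z))
  simp [doubleIntegral, this]

/-- The `p`-th root of the four-well energy is Lipschitz with respect to the `L^p`-norm. -/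
lemma rpow_lintegral_fourWellIntegrand_le {E : Type*} [MeasurableSpace E] {μ : Measure E}
    [IsFiniteMeasure μ] {p : ℝ} (hp : 1 < p) {f v : E → ℝ} (hf : Measurable f)
    (hv : Measurable v) :
    (∫⁻ y, ∫⁻ x, ENNReal.ofReal (fourWellIntegrand p (f x, f y)) ∂μ ∂μ) ^ (1 / p) ≤
      (∫⁻ y, ∫⁻ x, ENNReal.ofReal (fourWellIntegrand p (v x, v y)) ∂μ ∂μ) ^ (1 / p) +
        2 * μ Set.univ ^ (1 / p) * eLpNorm (v - f) (ENNReal.ofReal p) μ := by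
  have hp0 : 0 < p := by linarith
  let D : (E → ℝ) → E × E → ENNReal := fun w z => ENNReal.ofReal (dist₁ (w z.1, w z.2) fourWells)
  have hD : ∀ w : E → ℝ, Measurable w → Measurable (D w) := fun w hw =>
    ENNReal.measurable_ofReal.comp ((continuous_dist₁ fourWells).measurable.comp
      ((hw.comp measurable_fst).prodMk (hw.comp measurable_snd)))
  have hI : ∀ w : E → ℝ, Measurable w →
      ∫⁻ y, ∫⁻ x, ENNReal.ofReal (fourWellIntegrand p (w x, w y)) ∂μ ∂μ =
        ∫⁻ z, D w z ^ p ∂(μ.prod μ) := by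
    intro w hw
    rw [lintegral_prod_symm' _ ((hD w hw).pow_const p)]
    simp only [fourWellIntegrand, D, ENNReal.ofReal_rpow_of_nonneg (dist₁_nonneg _ _) hp0.le]
  let e : E → ENNReal := fun x => ‖(v - f) x‖ₑ
  have he : Measurable e := (hv.sub hf).enorm
  have hN : (∫⁻ x, e x ^ p ∂μ) ^ (1 / p) = eLpNorm (v - f) (ENNReal.ofReal p) μ := by
    rw [eLpNorm_eq_lintegral_rpow_enorm_toReal (by simpa using hp0) ENNReal.ofReal_ne_top,
      ENNReal.toReal_ofReal hp0.le]
  have he1 : (∫⁻ z : E × E, e z.1 ^ p ∂(μ.prod μ)) ^ (1 / p) =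
      μ Set.univ ^ (1 / p) * eLpNorm (v - f) (ENNReal.ofReal p) μ := by
    rw [lintegral_prod (fun z : E × E => e z.1 ^ p) ((he.comp measurable_fst).pow_const p).aemeasurable, ← hN]
    simp only [lintegral_const]
    rw [lintegral_mul_const _ (he.pow_const p), mul_comm, ENNReal.mul_rpow_of_nonneg _ _ (by positivity)]
  have he2 : (∫⁻ z : E × E, e z.2 ^ p ∂(μ.prod μ)) ^ (1 / p) =
      μ Set.univ ^ (1 / p) * eLpNorm (v - f) (ENNReal.ofReal p) μ := by
    rw [lintegral_prod (fun z : E × E => e z.2 ^ p) ((he.comp measurable_snd).pow_const p).aemeasurable, ← hN]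
    simp only [lintegral_const]
    rw [mul_comm, ENNReal.mul_rpow_of_nonneg _ _ (by positivity)]
  -- The distance is 1-Lipschitz in the 1-norm; Minkowski's inequality on the product space does the
  -- rest.
  have hle : ∀ z, D f z ≤ (D v + ((fun z : E × E => e z.1) + fun z : E × E => e z.2)) z := by
    intro z
    have h := dist₁_le_add (f z.1) (f z.2) (v z.1) (v z.2) fourWells
    refine (ENNReal.ofReal_le_ofReal h).trans ?_
    rw [ENNReal.ofReal_add (dist₁_nonneg _ _) (by positivity),
      ENNReal.ofReal_add (abs_nonneg _) (abs_nonneg _)]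
    simp only [Pi.add_apply, e, D, Pi.sub_apply, Real.enorm_eq_ofReal_abs, abs_sub_comm]
    exact le_rfl
  rw [hI f hf, hI v hv]
  calc (∫⁻ z, D f z ^ p ∂(μ.prod μ)) ^ (1 / p)
      ≤ (∫⁻ z, (D v + ((fun z : E × E => e z.1) + fun z : E × E => e z.2)) z ^ p ∂(μ.prod μ)) ^ (1 / p) := by
        gcongr with z
        exact hle z
    _ ≤ (∫⁻ z, D v z ^ p ∂(μ.prod μ)) ^ (1 / p) +
        (∫⁻ z, ((fun z : E × E => e z.1) + fun z : E × E => e z.2) z ^ p ∂(μ.prod μ)) ^ (1 / p) :=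
        ENNReal.lintegral_Lp_add_le (hD v hv).aemeasurable
          ((he.comp measurable_fst).add (he.comp measurable_snd)).aemeasurable hp.le
    _ ≤ (∫⁻ z, D v z ^ p ∂(μ.prod μ)) ^ (1 / p) +
        ((∫⁻ z : E × E, e z.1 ^ p ∂(μ.prod μ)) ^ (1 / p) +
          (∫⁻ z : E × E, e z.2 ^ p ∂(μ.prod μ)) ^ (1 / p)) := by
        gcongr
        exact ENNReal.lintegral_Lp_add_le (he.comp measurable_fst).aemeasurable
          (he.comp measurable_snd).aemeasurable hp.le
    _ = _ := by rw [he1, he2, mul_assoc, two_mul]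

/-- Simple functions are dense in `L^p`, and both the energy and the mean are continuous there. -/
lemma exists_finiteEnergy_lt_of_doubleIntegral_lt {n : ℕ} {p : ℝ} (hp : 1 < p)
    {Ω : Set (EuclideanSpace ℝ (Fin n))} (hΩ : volume Ω ≠ ⊤) (v : LpOn p Ω) {c : ℝ}
    (hc : doubleIntegral (fourWellIntegrand p) v < c) {ε : ℝ} (hε : 0 < ε) :
    ∃ (ι : Type) (_ : Fintype ι) (s m : ι → ℝ), (∀ i, 0 ≤ m i) ∧
      ∑ i, m i = (volume.restrict Ω).real Set.univ ∧
      finiteEnergy (fourWellIntegrand p) s m < c ∧ |∑ i, m i * s i - ∫ x in Ω, v x| < ε := by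
  set μ := volume.restrict Ω
  have : IsFiniteMeasure μ := ⟨by simpa [μ] using hΩ.lt_top⟩
  have hp0 : 0 < p := by linarith
  have hvm : Measurable v := (Lp.stronglyMeasurable v).measurable
  have hvL := Lp.memLp v
  rw [doubleIntegral_fourWellIntegrand] at hc
  set I := ∫⁻ y, ∫⁻ x, ENNReal.ofReal (fourWellIntegrand p (v x, v y)) ∂μ ∂μ with hI
  have hc0 : 0 < c := by
    have : (0 : EReal) < c := lt_of_le_of_lt (EReal.coe_ennreal_nonneg I) hc
    exact_mod_cast this
  have hIc : I < ENNReal.ofReal c := by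
    rw [← EReal.coe_ennreal_lt_coe_ennreal_iff, EReal.coe_ennreal_ofReal, max_eq_left hc0.le]
    exact hc
  have hIc' : I ^ (1 / p) < ENNReal.ofReal c ^ (1 / p) := ENNReal.rpow_lt_rpow hIc (by positivity)
  have hC1 : 2 * μ Set.univ ^ (1 / p) ≠ ⊤ := ENNReal.mul_ne_top (by simp)
    (ENNReal.rpow_ne_top_of_nonneg (by positivity) (measure_ne_top _ _))
  have hC2 : μ Set.univ ^ (1 / (1 : ENNReal).toReal - 1 / (ENNReal.ofReal p).toReal) ≠ ⊤ := by
    refine ENNReal.rpow_ne_top_of_nonneg ?_ (measure_ne_top _ _)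
    rw [ENNReal.toReal_ofReal hp0.le]
    simpa using inv_le_one_of_one_le₀ hp.le
  have ht1 : Tendsto (fun δ => I ^ (1 / p) + 2 * μ Set.univ ^ (1 / p) * δ) (𝓝[>] 0)
      (𝓝 (I ^ (1 / p))) := by
    have : Continuous fun δ => I ^ (1 / p) + 2 * μ Set.univ ^ (1 / p) * δ :=
      continuous_const.add (ENNReal.continuous_const_mul hC1)
    simpa using (this.tendsto 0).mono_left nhdsWithin_le_nhds
  have ht2 : Tendsto (fun δ => δ * μ Set.univ ^ (1 / (1 : ENNReal).toReal -
      1 / (ENNReal.ofReal p).toReal)) (𝓝[>] 0) (𝓝 0) := by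
    simpa using ((ENNReal.continuous_mul_const hC2).tendsto 0).mono_left nhdsWithin_le_nhds
  obtain ⟨δ, ⟨h1, h2⟩, hδ⟩ := ((ht1.eventually_lt_const hIc').and
    (ht2.eventually_lt_const (ENNReal.ofReal_pos.2 hε))).and self_mem_nhdsWithin |>.exists
  obtain ⟨f, hfδ, hfL⟩ := hvL.exists_simpleFunc_eLpNorm_sub_lt ENNReal.ofReal_ne_top
    (ne_of_gt hδ)
  let κ : EuclideanSpace ℝ (Fin n) → f.range := fun x => ⟨f x, f.mem_range_self x⟩
  have hκ : Measurable κ := f.measurable.subtype_mk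
  have hfI := lintegral_lintegral_ofReal_of_labels (μ := μ) (fourWellIntegrand p)
    (fourWellIntegrand_nonneg p) hκ (fun i => (i : ℝ)) (u := f) (ae_of_all _ fun x => rfl)
  refine ⟨f.range, inferInstance, fun i => i, fun i => μ.real (κ ⁻¹' {i}),
    fun i => measureReal_nonneg, ?_, ?_, ?_⟩
  · have := integral_fintype (μ := μ.map κ) (f := fun _ => (1 : ℝ)) (integrable_const _)
    simp only [integral_const, smul_eq_mul, mul_one, map_measureReal_apply hκ MeasurableSet.univ,
      map_measureReal_apply hκ (measurableSet_singleton _), Set.preimage_univ] at this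
    exact this.symm
  · have h3 := rpow_lintegral_fourWellIntegrand_le (μ := μ) hp f.measurable hvm
    rw [← hI, hfI] at h3
    have h4 : ENNReal.ofReal (finiteEnergy (fourWellIntegrand p) (fun i : f.range => (i : ℝ))
        fun i => μ.real (κ ⁻¹' {i})) ^ (1 / p) < ENNReal.ofReal c ^ (1 / p) := by
      refine lt_of_le_of_lt (h3.trans ?_) h1
      gcongr
    rw [ENNReal.rpow_lt_rpow_iff (by positivity)] at h4
    exact (ENNReal.ofReal_lt_ofReal_iff hc0).1 h4
  · have h5 : ∑ i : f.range, μ.real (κ ⁻¹' {i}) * (i : ℝ) = ∫ x, f x ∂μ := by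
      have h6 := integral_fintype (μ := μ.map κ) (f := fun i : f.range => (i : ℝ))
        (Integrable.of_finite)
      simp only [smul_eq_mul, map_measureReal_apply hκ (measurableSet_singleton _)] at h6
      rw [← h6, integral_map hκ.aemeasurable (measurable_of_finite _).aestronglyMeasurable]
    have hle1 : (1 : ENNReal) ≤ ENNReal.ofReal p := by simpa using hp.le
    have hvi := hvL.integrable hle1
    have hfi := hfL.integrable hle1
    rw [h5, ← integral_sub hfi hvi, ← Real.norm_eq_abs,
      ← ENNReal.ofReal_lt_ofReal_iff hε]
    calc ENNReal.ofReal ‖∫ x, (f x - v x) ∂μ‖ = ‖∫ x, (f x - v x) ∂μ‖ₑ := ofReal_norm _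
      _ ≤ ∫⁻ x, ‖f x - v x‖ₑ ∂μ := enorm_integral_le_lintegral_enorm _
      _ = eLpNorm (⇑v - ⇑f) 1 μ := by
          rw [eLpNorm_one_eq_lintegral_enorm]
          refine lintegral_congr fun x => ?_
          rw [Pi.sub_apply, ← enorm_neg, neg_sub]
      _ ≤ eLpNorm (⇑v - ⇑f) (ENNReal.ofReal p) μ * μ Set.univ ^ (1 / (1 : ENNReal).toReal -
            1 / (ENNReal.ofReal p).toReal) :=
          eLpNorm_le_eLpNorm_mul_rpow_measure_univ hle1
            (hvm.sub f.measurable).aestronglyMeasurable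
      _ ≤ δ * μ Set.univ ^ (1 / (1 : ENNReal).toReal - 1 / (ENNReal.ofReal p).toReal) := by
          gcongr
      _ < ENNReal.ofReal ε := h2

/-- Weak relaxation values of the four-well energy are attained up to an error by functions with
finitely many values. -/
theorem exists_finiteEnergy_lt_of_weakRelaxation_lt {n : ℕ} {p : ℝ} (hp : 1 < p)
    {Ω : Set (EuclideanSpace ℝ (Fin n))} (hΩ : volume Ω ≠ ⊤) (u : LpOn p Ω) {c : ℝ}
    (hc : weakRelaxation (doubleIntegral (fourWellIntegrand p)) u < c) {ε : ℝ} (hε : 0 < ε) :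
    ∃ (ι : Type) (_ : Fintype ι) (s m : ι → ℝ), (∀ i, 0 ≤ m i) ∧
      ∑ i, m i = (volume.restrict Ω).real Set.univ ∧
      finiteEnergy (fourWellIntegrand p) s m < c ∧ |∑ i, m i * s i - ∫ x in Ω, u x| < ε := by
  have : IsFiniteMeasure (volume.restrict Ω) := ⟨by simpa using hΩ.lt_top⟩
  obtain ⟨_, ⟨v, hv, rfl⟩, hlt⟩ := sInf_lt_iff.1 hc
  have hfreq := frequently_lt_of_liminf_lt (by isBoundedDefault) hlt
  -- Of weak convergence only the test function `1` is needed: it gives convergence of the means.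
  have hone : ∀ w : LpOn p Ω, ∫ x in Ω, w x * (Lp.const (ENNReal.ofReal p.conjExponent)
      (volume.restrict Ω) (1 : ℝ)) x = ∫ x in Ω, w x := by
    intro w
    refine integral_congr_ae ?_
    filter_upwards [Lp.coeFn_const (p := ENNReal.ofReal p.conjExponent)
      (μ := volume.restrict Ω) (1 : ℝ)] with x hx
    rw [hx]; simp
  have hlim := hv (Lp.const _ _ (1 : ℝ))
  simp only [hone] at hlim
  obtain ⟨j, hj, hj'⟩ :=
    (hfreq.and_eventually ((Metric.tendsto_nhds.1 hlim) (ε / 2) (half_pos hε))).exists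
  obtain ⟨ι, _, s, m, h1, h2, h3, h4⟩ :=
    exists_finiteEnergy_lt_of_doubleIntegral_lt hp hΩ (v j) hj (half_pos hε)
  refine ⟨ι, _, s, m, h1, h2, h3, ?_⟩
  rw [Real.dist_eq] at hj'
  calc |∑ i, m i * s i - ∫ x in Ω, u x|
      ≤ |∑ i, m i * s i - ∫ x in Ω, v j x| + |(∫ x in Ω, v j x) - ∫ x in Ω, u x| :=
        abs_sub_le _ _ _
    _ < ε := by linarith

/-! ### Free choice of signs -/

lemma finiteEnergy_const_mul {ι : Type} [Fintype ι] (G : ℝ × ℝ → ℝ) (s m : ι → ℝ) (c : ℝ) :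
    finiteEnergy G s (fun i => c * m i) = c ^ 2 * finiteEnergy G s m := by
  simp only [finiteEnergy, Finset.mul_sum]
  exact Finset.sum_congr rfl fun i _ => Finset.sum_congr rfl fun k _ => by ring

/-- The four-well energy does not see the signs of the values. -/
lemma finiteEnergy_fourWellIntegrand_signs {ι : Type} [Fintype ι] (p : ℝ) (s m : ι → ℝ)
    (s' m' : ι × Bool → ℝ) (hs : ∀ i σ, |s' (i, σ)| = |s i|)
    (hm : ∀ i, m' (i, true) + m' (i, false) = m i) :
    finiteEnergy (fourWellIntegrand p) s' m' = finiteEnergy (fourWellIntegrand p) s m := by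
  simp only [finiteEnergy, Fintype.sum_prod_type, Fintype.sum_bool]
  refine Finset.sum_congr rfl fun i _ => ?_
  rw [← Finset.sum_add_distrib]
  refine Finset.sum_congr rfl fun k _ => ?_
  have h : ∀ σ τ, fourWellIntegrand p (s' (i, σ), s' (k, τ)) = fourWellIntegrand p (s i, s k) :=
    fun σ τ => fourWellIntegrand_congr p (hs i σ) (hs k τ)
  simp only [h, ← hm]
  ring

lemma exists_abs_le_one_mul_eq {a r : ℝ} (h : |a| ≤ r) : ∃ τ : ℝ, |τ| ≤ 1 ∧ τ * r = a := by
  rcases eq_or_ne r 0 with rfl | hr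
  · exact ⟨0, by simp, by simpa using (abs_nonpos_iff.1 h).symm⟩
  · have hr0 : 0 < r := lt_of_le_of_ne ((abs_nonneg a).trans h) hr.symm
    exact ⟨a / r, by rwa [abs_div, abs_of_pos hr0, div_le_one hr0], div_mul_cancel₀ a hr⟩

/-- Each value is split into `|s i|` and `-|s i|`, in proportions chosen separately on `A` and on
its complement. This tunes the two means to `a` and `b` and leaves the energy unchanged. -/
theorem weakRelaxation_le_finiteEnergy_of_abs_le {n : ℕ} (hn : 1 ≤ n) {p : ℝ} (hp : 1 < p)
    {Ω : Set (EuclideanSpace ℝ (Fin n))} (hΩm : MeasurableSet Ω) (hΩ : volume Ω ≠ ⊤)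
    {ι : Type} [Fintype ι] {P R : ι → ℝ} (hP : ∀ i, 0 ≤ P i)
    (hP1 : ∑ i, P i = 1) (hR : ∀ i, 0 ≤ R i) (hR1 : ∑ i, R i = 1) (s : ι → ℝ)
    {A : Set (EuclideanSpace ℝ (Fin n))} (hA : MeasurableSet A) (u : LpOn p Ω) {a b : ℝ}
    (ha : |a| ≤ ∑ i, P i * |s i|) (hb : |b| ≤ ∑ i, R i * |s i|)
    (huA : ∀ᵐ x ∂volume.restrict Ω, x ∈ A → u x = a)
    (huA' : ∀ᵐ x ∂volume.restrict Ω, x ∉ A → u x = b) :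
    weakRelaxation (doubleIntegral (fourWellIntegrand p)) u ≤
      ((finiteEnergy (fourWellIntegrand p) s fun i => P i * (volume.restrict Ω).real A +
        R i * (volume.restrict Ω).real Aᶜ : ℝ) : EReal) := by
  obtain ⟨τ, hτ, hτa⟩ := exists_abs_le_one_mul_eq ha
  obtain ⟨τ', hτ', hτb⟩ := exists_abs_le_one_mul_eq hb
  have aux : ∀ (Q : ι → ℝ) (t : ℝ), (∀ i, 0 ≤ Q i) → ∑ i, Q i = 1 → |t| ≤ 1 →
      ∃ Q' : ι × Bool → ℝ, (∀ i, 0 ≤ Q' i) ∧ ∑ i, Q' i = 1 ∧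
        (∀ i, Q' (i, true) + Q' (i, false) = Q i) ∧
        ∑ i, Q' i * (if i.2 then |s i.1| else -|s i.1|) = t * ∑ i, Q i * |s i| := by
    intro Q t hQ hQ1 ht
    obtain ⟨ht1, ht2⟩ := abs_le.1 ht
    -- Weights `(1 ± t) / 2` on the two signs multiply the mean of `|s|` by `t`.
    refine ⟨fun i => Q i.1 * (if i.2 then (1 + t) / 2 else (1 - t) / 2), fun i => ?_, ?_,
      fun i => ?_, ?_⟩
    · refine mul_nonneg (hQ _) ?_
      split_ifs <;> linarith
    · refine Eq.trans ?_ hQ1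
      simp only [Fintype.sum_prod_type, Fintype.sum_bool, if_true, Bool.false_eq_true, if_false]
      exact Finset.sum_congr rfl fun i _ => by ring
    · simp only [if_true, Bool.false_eq_true, if_false]; ring
    · rw [Finset.mul_sum]
      simp only [Fintype.sum_prod_type, Fintype.sum_bool, if_true, Bool.false_eq_true, if_false]
      exact Finset.sum_congr rfl fun i _ => by ring
  obtain ⟨P', hP'0, hP'1, hP's, hP'm⟩ := aux P τ hP hP1 hτ
  obtain ⟨R', hR'0, hR'1, hR's, hR'm⟩ := aux R τ' hR hR1 hτ'
  have h := weakRelaxation_le_finiteEnergy hn hp hΩm hΩ (fourWellIntegrand p) hP'0 hP'1 hR'0 hR'1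
    (fun i => if i.2 then |s i.1| else -|s i.1|) hA u (by rwa [hP'm, hτa]) (by rwa [hR'm, hτb])
  refine h.trans_eq ?_
  rw [finiteEnergy_fourWellIntegrand_signs p s (fun i => P i * (volume.restrict Ω).real A +
        R i * (volume.restrict Ω).real Aᶜ)]
  · intro i σ
    cases σ <;> simp
  · intro i
    rw [← hP's, ← hR's]; ring

lemma exists_twoValued {n : ℕ} {p : ℝ} {Ω : Set (EuclideanSpace ℝ (Fin n))}
    (hΩ : volume Ω ≠ ⊤) {A : Set (EuclideanSpace ℝ (Fin n))} (hA : MeasurableSet A) (a b : ℝ) :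
    ∃ u : LpOn p Ω, (∀ᵐ x ∂volume.restrict Ω, x ∈ A → u x = a) ∧
      (∀ᵐ x ∂volume.restrict Ω, x ∉ A → u x = b) ∧
      ∀ G : ℝ × ℝ → ℝ, SymmetricIntegrand G → doubleIntegral G u =
        (((volume.restrict Ω).real A ^ 2 * G (a, a) +
          2 * (volume.restrict Ω).real A * (volume.restrict Ω).real Aᶜ * G (a, b) +
          (volume.restrict Ω).real Aᶜ ^ 2 * G (b, b) : ℝ) : EReal) := by
  classical
  have : IsFiniteMeasure (volume.restrict Ω) := ⟨by simpa using hΩ.lt_top⟩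
  let κ : EuclideanSpace ℝ (Fin n) → Bool := fun x => if x ∈ A then true else false
  have hκ : Measurable κ := Measurable.ite hA measurable_const measurable_const
  let s : Bool → ℝ := fun σ => if σ then a else b
  have hmem : MemLp (fun x => s (κ x)) (ENNReal.ofReal p) (volume.restrict Ω) := by
    refine MemLp.of_bound ((measurable_of_finite s).comp hκ).aestronglyMeasurable (|a| + |b|)
      (ae_of_all _ fun x => ?_)
    cases h : κ x <;> simp [s]
  have hu := hmem.coeFn_toLp
  refine ⟨hmem.toLp _, hu.mono fun x hx h => ?_, hu.mono fun x hx h => ?_, fun G hG => ?_⟩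
  · rw [hx]; simp [s, κ, h]
  · rw [hx]; simp [s, κ, h]
  · rw [doubleIntegral_of_labels hΩ G _ hκ s hu]
    have h1 : κ ⁻¹' {true} = A := by ext x; simp [κ]
    have h2 : κ ⁻¹' {false} = Aᶜ := by ext x; simp [κ]
    simp only [finiteEnergy, Fintype.sum_bool, h1, h2, s, if_true, Bool.false_eq_true, if_false,
      hG b a]
    congr 1
    ring

/-! ### Spread of low-energy configurations, and small sets -/

/-- Configurations of low four-well energy are not concentrated near the mean of `|s|`: the part of
the mass above the mean is bounded below, and so is the gain of its mean. -/
lemma exists_mass_above_mean {p : ℝ} (hp : 1 < p) :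
    ∃ θ κ : ℝ, 0 < θ ∧ θ ≤ 1 / 2 ∧ 0 < κ ∧ ∀ (ι : Type) [Fintype ι] (s P : ι → ℝ),
      (∀ i, 0 ≤ P i) → ∑ i, P i = 1 → finiteEnergy (fourWellIntegrand p) s P ≤ 3 / 4 →
      ∃ Q : ι → ℝ, (∀ i, 0 ≤ Q i) ∧ (∀ i, Q i ≤ P i) ∧ θ ≤ ∑ i, Q i ∧
        (∑ i, P i * |s i| + κ) * ∑ i, Q i ≤ ∑ i, Q i * |s i| := by
  classical
  set κ : ℝ := 1 / (16 * p) with hκ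
  have hκ0 : 0 < κ := by positivity
  obtain ⟨C, hC, hW⟩ := exists_abs_le_fourWellIntegrand hp (half_pos hκ0)
  refine ⟨min (κ / (2 * C)) (1 / 2), κ, by positivity, min_le_right _ _, hκ0, ?_⟩
  intro ι _ s P hP hP1 hE
  set r := ∑ i, P i * |s i| with hr
  have hr0 : 0 ≤ r := Finset.sum_nonneg fun i _ => mul_nonneg (hP i) (abs_nonneg _)
  let Q : ι → ℝ := fun i => if r < |s i| then P i else 0
  have hQ0 : ∀ i, 0 ≤ Q i := fun i => by simp only [Q]; split_ifs; exacts [hP i, le_rfl]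
  have hQP : ∀ i, Q i ≤ P i := fun i => by simp only [Q]; split_ifs; exacts [le_rfl, hP i]
  have hQ1 : ∑ i, Q i ≤ 1 := hP1 ▸ Finset.sum_le_sum fun i _ => hQP i
  have hdouble : ∀ f : ι → ℝ, ∑ i, ∑ k, P i * P k * f i = ∑ i, P i * f i := by
    intro f
    refine Finset.sum_congr rfl fun i _ => ?_
    calc ∑ k, P i * P k * f i = P i * f i * ∑ k, P k := by
          rw [Finset.mul_sum]; exact Finset.sum_congr rfl fun k _ => by ring
      _ = P i * f i := by rw [hP1, mul_one]
  have hdouble' : ∀ f : ι → ℝ, ∑ i, ∑ k, P i * P k * f k = ∑ i, P i * f i := by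
    intro f
    rw [Finset.sum_comm, ← hdouble f]
    exact Finset.sum_congr rfl fun i _ => Finset.sum_congr rfl fun k _ => by ring
  -- With energy at most `3/4` this forces mean absolute deviation at least `1 / (8 * p)`. Half of
  -- it lies above the mean, hence `κ = 1 / (16 * p)`.
  have h1 : 1 - 2 * p * ∑ i, P i * |(|s i| - r)| ≤ finiteEnergy (fourWellIntegrand p) s P := by
    have : 1 - 2 * p * ∑ i, P i * |(|s i| - r)| = ∑ i, ∑ k, (P i * P k * 1
        - p * (P i * P k * |(|s i| - r)|) - p * (P i * P k * |(|s k| - r)|)) := by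
      simp only [Finset.sum_sub_distrib, ← Finset.mul_sum]
      rw [hdouble' fun i => |(|s i| - r)|]
      have := hdouble fun i => |(|s i| - r)|
      have h1 := hdouble fun _ => 1
      simp only [mul_one, ← Finset.mul_sum, hP1] at h1 ⊢
      simp only [← Finset.sum_mul, ← Finset.mul_sum, hP1, mul_one]
      ring
    rw [this]
    refine Finset.sum_le_sum fun i _ => Finset.sum_le_sum fun k _ => ?_
    have h2 := one_sub_mul_le_fourWellIntegrand hp.le (s i) (s k)
    have h3 : |(|s i| - |s k|)| ≤ |(|s i| - r)| + |(|s k| - r)| := by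
      have := abs_sub_le (|s i|) r (|s k|)
      rwa [abs_sub_comm r] at this
    have h4 : 0 ≤ P i * P k := mul_nonneg (hP i) (hP k)
    have h5 : 1 - p * (|(|s i| - r)| + |(|s k| - r)|) ≤ fourWellIntegrand p (s i, s k) := by
      nlinarith
    nlinarith
  have h2 : ∑ i, P i * |(|s i| - r)| = 2 * ∑ i, Q i * (|s i| - r) := by
    have h3 : ∑ i, P i * (|s i| - r) = 0 := by
      simp only [mul_sub, Finset.sum_sub_distrib, ← Finset.sum_mul, hP1, ← hr]
      ring
    have h4 : ∀ i, P i * |(|s i| - r)| = 2 * (Q i * (|s i| - r)) - P i * (|s i| - r) := by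
      intro i
      simp only [Q]
      split_ifs with h
      · rw [abs_of_pos (by linarith)]; ring
      · rw [abs_of_nonpos (by linarith)]; ring
    simp only [h4, Finset.sum_sub_distrib, h3, sub_zero, Finset.mul_sum]
  have h3 : κ ≤ ∑ i, Q i * (|s i| - r) := by
    rw [h2] at h1
    rw [hκ, div_le_iff₀ (by positivity)]
    linarith
  have h4 : ∑ i, Q i * (|s i| - r) = ∑ i, Q i * |s i| - r * ∑ i, Q i := by
    simp only [mul_sub, Finset.sum_sub_distrib, ← Finset.sum_mul]; ring
  refine ⟨Q, hQ0, hQP, (min_le_left _ _).trans ?_, ?_⟩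
  · have hQs : ∑ i, Q i * |s i| ≤ κ / 2 * finiteEnergy (fourWellIntegrand p) s P
        + C * ∑ i, Q i := by
      rw [finiteEnergy, Finset.mul_sum, Finset.mul_sum, ← Finset.sum_add_distrib]
      refine Finset.sum_le_sum fun i _ => ?_
      have : Q i * |s i| = ∑ k, P k * (Q i * |s i|) := by rw [← Finset.sum_mul, hP1, one_mul]
      have h6 : C * Q i = ∑ k, P k * (C * Q i) := by rw [← Finset.sum_mul, hP1, one_mul]
      rw [this, h6, Finset.mul_sum, ← Finset.sum_add_distrib]
      refine Finset.sum_le_sum fun k _ => ?_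
      have h7 : Q i * |s i| ≤ κ / 2 * (P i * fourWellIntegrand p (s i, s k)) + C * Q i := by
        have h8 := mul_le_mul_of_nonneg_left (hW (s i) (s k)) (hQ0 i)
        have h9 := mul_le_mul_of_nonneg_right (hQP i) (fourWellIntegrand_nonneg p (s i, s k))
        nlinarith
      calc P k * (Q i * |s i|) ≤ P k * (κ / 2 * (P i * fourWellIntegrand p (s i, s k)) + C * Q i) :=
            mul_le_mul_of_nonneg_left h7 (hP k)
        _ = _ := by ring
    have hrQ : 0 ≤ r * ∑ i, Q i := mul_nonneg hr0 (Finset.sum_nonneg fun i _ => hQ0 i)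
    rw [div_le_iff₀ (by positivity)]
    nlinarith
  · nlinarith

lemma exists_small_measurableSet {n : ℕ} (hn : 1 ≤ n) {Ω : Set (EuclideanSpace ℝ (Fin n))}
    (hne : Ω.Nonempty) (hopen : IsOpen Ω) {δ : ℝ} (hδ : 0 < δ) :
    ∃ A : Set (EuclideanSpace ℝ (Fin n)), MeasurableSet A ∧
      0 < (volume.restrict Ω).real A ∧ (volume.restrict Ω).real A < δ := by
  obtain ⟨x, hx⟩ := hne
  obtain ⟨r, hr, hball⟩ := Metric.isOpen_iff.1 hopen x hx
  have ht : Tendsto (fun t : ℝ => t ^ n * (volume : Measure (EuclideanSpace ℝ (Fin n))).real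
      (Metric.ball 0 1)) (𝓝[>] 0) (𝓝 0) := by
    have : Continuous fun t : ℝ => t ^ n * (volume : Measure (EuclideanSpace ℝ (Fin n))).real
      (Metric.ball 0 1) := by fun_prop
    simpa [zero_pow (by omega : n ≠ 0)] using (this.tendsto 0).mono_left nhdsWithin_le_nhds
  obtain ⟨t, ⟨h1, h2⟩, h3⟩ := ((ht.eventually_lt_const hδ).and
    (nhdsWithin_le_nhds (eventually_lt_nhds hr))).and self_mem_nhdsWithin |>.exists
  have ht0 : 0 < t := h3
  have heq : (volume.restrict Ω).real (Metric.ball x t) =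
      t ^ n * (volume : Measure (EuclideanSpace ℝ (Fin n))).real (Metric.ball 0 1) := by
    rw [measureReal_restrict_apply Metric.isOpen_ball.measurableSet,
      Set.inter_eq_left.2 ((Metric.ball_subset_ball h2.le).trans hball),
      measureReal_def, Measure.addHaar_ball_of_pos _ _ ht0, finrank_euclideanSpace_fin,
      ENNReal.toReal_mul, ENNReal.toReal_ofReal (by positivity), measureReal_def]
  refine ⟨Metric.ball x t, Metric.isOpen_ball.measurableSet, ?_, heq ▸ h1⟩
  rw [heq]
  refine mul_pos (pow_pos ht0 n) ?_
  exact ENNReal.toReal_pos (Metric.measure_ball_pos _ _ one_pos).ne' measure_ball_lt_top.ne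

/-! ### The contradiction -/

theorem proposition4p1 (n : ℕ) (hn : 1 ≤ n) (p : ℝ) (hp : 1 < p)
    (Ω : Set (EuclideanSpace ℝ (Fin n))) (hΩ_ne : Ω.Nonempty) (hΩ_open : IsOpen Ω)
    (hΩ_bdd : Bornology.IsBounded Ω) :
    ¬ ∃ G : ℝ × ℝ → ℝ, SymmetricIntegrand G ∧ LowerSemicontinuous G ∧ HasPGrowth p G ∧
      ∀ u : LpOn p Ω,
        weakRelaxation (doubleIntegral (fourWellIntegrand p)) u = doubleIntegral G u := by
  rintro ⟨G, hsym, hlsc, -, hrel⟩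
  have hΩ : volume Ω ≠ ⊤ := hΩ_bdd.measure_lt_top.ne
  have hΩm := hΩ_open.measurableSet
  have : IsFiniteMeasure (volume.restrict Ω) := ⟨by simpa using hΩ.lt_top⟩
  set μ := volume.restrict Ω with hμ
  set M := μ.real Set.univ with hM
  have hM0 : 0 < M := by
    rw [hM, hμ, measureReal_restrict_apply_univ]
    exact ENNReal.toReal_pos (hΩ_open.measure_pos _ hΩ_ne).ne' hΩ
  have hcompl : ∀ A, MeasurableSet A → μ.real Aᶜ = M - μ.real A := fun A hA =>
    measureReal_compl hA
  set W := fourWellIntegrand p with hW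
  set Z := G (0, 0) with hZ
  have hconst : ∀ a : ℝ, ∃ u : LpOn p Ω, (∀ᵐ x ∂μ, u x = a) ∧
      doubleIntegral G u = ((M ^ 2 * G (a, a) : ℝ) : EReal) := by
    intro a
    obtain ⟨u, h1, -, h2⟩ := exists_twoValued (p := p) hΩ MeasurableSet.univ a a
    refine ⟨u, by simpa using h1, ?_⟩
    rw [h2 G hsym]
    simp [hM, hμ]
  -- every finite configuration has at least the energy of the relaxation at zero
  have hfin : ∀ (ι : Type) [Fintype ι] (s P : ι → ℝ), (∀ i, 0 ≤ P i) → ∑ i, P i = 1 →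
      Z ≤ finiteEnergy W s P := by
    intro ι _ s P hP hP1
    obtain ⟨u, hu, hGu⟩ := hconst 0
    have hnn : |(0 : ℝ)| ≤ ∑ i, P i * |s i| := by
      rw [abs_zero]; exact Finset.sum_nonneg fun i _ => mul_nonneg (hP i) (abs_nonneg _)
    have h := weakRelaxation_le_finiteEnergy_of_abs_le hn hp hΩm hΩ hP hP1 hP hP1 s
      MeasurableSet.univ u hnn hnn (hu.mono fun x hx _ => hx) (hu.mono fun x hx _ => hx)
    rw [hrel, hGu, EReal.coe_le_coe_iff] at h
    simp only [Set.compl_univ, measureReal_empty, mul_zero, add_zero] at h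
    simp only [← hμ, ← hM, mul_comm _ M, finiteEnergy_const_mul] at h
    exact le_of_mul_le_mul_left h (by positivity)
  have hlow : ∀ (u : LpOn p Ω) (c : ℝ), weakRelaxation (doubleIntegral W) u <
      ((M ^ 2 * c : ℝ) : EReal) → ∀ ε > 0, ∃ (ι : Type) (_ : Fintype ι) (s P : ι → ℝ),
        (∀ i, 0 ≤ P i) ∧ ∑ i, P i = 1 ∧ finiteEnergy W s P < c ∧
          |∑ i, P i * s i - (∫ x in Ω, u x) / M| < ε := by
    intro u c hc ε hε
    obtain ⟨ι, hι, s, m, h1, h2, h3, h4⟩ :=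
      exists_finiteEnergy_lt_of_weakRelaxation_lt hp hΩ u hc (mul_pos hM0 hε)
    refine ⟨ι, hι, s, fun i => M⁻¹ * m i, fun i => mul_nonneg (by positivity) (h1 i), ?_, ?_, ?_⟩
    · rw [← Finset.mul_sum, h2, inv_mul_cancel₀ hM0.ne']
    · rw [finiteEnergy_const_mul, inv_pow, inv_mul_lt_iff₀ (by positivity)]
      exact h3
    · have : ∑ i, M⁻¹ * m i * s i - (∫ x in Ω, u x) / M =
          M⁻¹ * (∑ i, m i * s i - ∫ x in Ω, u x) := by
        rw [mul_sub, Finset.mul_sum]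
        simp only [mul_assoc]
        ring
      rw [this, abs_mul, abs_of_pos (inv_pos.2 hM0), inv_mul_lt_iff₀ hM0]
      exact h4
  have hglob : ∀ u : LpOn p Ω, ((M ^ 2 * Z : ℝ) : EReal) ≤ doubleIntegral G u := by
    intro u
    by_contra! h
    obtain ⟨c, hc1, hc2⟩ := EReal.lt_iff_exists_real_btwn.1 h
    rw [EReal.coe_lt_coe_iff] at hc2
    have hcM : M ^ 2 * (c / M ^ 2) = c := by field_simp
    rw [← hrel, ← hcM] at hc1
    obtain ⟨ι, hι, s, P, h1, h2, h3, -⟩ := hlow u _ hc1 1 one_pos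
    have := hfin ι s P h1 h2
    have h5 : c / M ^ 2 < Z := by rw [div_lt_iff₀ (by positivity)]; linarith
    linarith
  have hdiag : ∀ a, Z ≤ G (a, a) := by
    intro a
    obtain ⟨u, -, hGu⟩ := hconst a
    have := hglob u
    rw [hGu, EReal.coe_le_coe_iff] at this
    exact le_of_mul_le_mul_left this (by positivity)
  -- Near-minimisers for the constant `a` have mean about `a`, so their mean of `|s|` is at least
  -- about `a`.
  have hdlow : ∀ a, G (a, a) = Z → ∀ ε > 0, ∃ (ι : Type) (_ : Fintype ι) (s P : ι → ℝ),
        (∀ i, 0 ≤ P i) ∧ ∑ i, P i = 1 ∧ finiteEnergy W s P < Z + ε ∧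
          a - ε ≤ ∑ i, P i * |s i| := by
    intro a ha ε hε
    obtain ⟨u, hu, hGu⟩ := hconst a
    have hlt : weakRelaxation (doubleIntegral W) u < ((M ^ 2 * (Z + ε) : ℝ) : EReal) := by
      rw [hrel, hGu, EReal.coe_lt_coe_iff, ha]
      have : 0 < M ^ 2 := by positivity
      nlinarith
    obtain ⟨ι, hι, s, P, h1, h2, h3, h4⟩ := hlow u _ hlt ε hε
    have hint : (∫ x in Ω, u x) / M = a := by
      rw [integral_congr_ae hu, integral_const, smul_eq_mul, ← hM, mul_div_cancel_left₀ _ hM0.ne']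
    rw [hint] at h4
    refine ⟨ι, hι, s, P, h1, h2, h3, ?_⟩
    have h5 : ∑ i, P i * s i ≤ ∑ i, P i * |s i| :=
      Finset.sum_le_sum fun i _ => mul_le_mul_of_nonneg_left (le_abs_self _) (h1 i)
    linarith [(abs_lt.1 h4).1]
  -- Equal masses at `0` and `1`: mixed pairs lie in the wells, equal pairs cost `1`.
  have hZhalf : Z ≤ 1 / 2 := by
    have h := hfin Bool (fun σ => if σ then 1 else 0) (fun _ => 1 / 2) (fun _ => by positivity)
      (by norm_num)
    have hp0 : p ≠ 0 := by linarith
    norm_num [finiteEnergy, hW, fourWellIntegrand, dist₁_fourWells, Real.zero_rpow hp0] at h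
    linarith
  -- the largest value `e` at which the relaxation of constants is minimal
  let S : Set ℝ := {a | 0 ≤ a ∧ G (a, a) = Z}
  have hSclosed : IsClosed S := by
    have h1 : S = Set.Ici 0 ∩ (fun a : ℝ => (a, a)) ⁻¹' (G ⁻¹' Set.Iic Z) := by
      ext a
      exact and_congr_right fun _ => ⟨fun h => h.le, fun h => le_antisymm h (hdiag a)⟩
    rw [h1]
    exact isClosed_Ici.inter ((hlsc.isClosed_preimage Z).preimage (by fun_prop))
  have hSne : S.Nonempty := ⟨0, le_rfl, rfl⟩
  have hSbdd : BddAbove S := by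
    obtain ⟨C, hC, hWC⟩ := exists_abs_le_fourWellIntegrand hp one_pos
    -- `a - 1` is at most the mean of `|s|`, which is below `Z + 1 + C`, and `Z ≤ 1 / 2`.
    refine ⟨C + 3, fun a ha => ?_⟩
    obtain ⟨ι, hι, s, P, h1, h2, h3, h4⟩ := hdlow a ha.2 1 one_pos
    have h5 : ∑ i, P i * |s i| ≤ finiteEnergy W s P + C := by
      have hC' : C = ∑ i, ∑ k, P i * P k * C := by
        simp only [← Finset.sum_mul, ← Finset.mul_sum, h2, mul_one, one_mul]
      rw [hC', finiteEnergy, ← Finset.sum_add_distrib]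
      refine Finset.sum_le_sum fun i _ => ?_
      have : P i * |s i| = ∑ k, P i * P k * |s i| := by
        rw [← Finset.sum_mul, ← Finset.mul_sum, h2, mul_one]
      rw [this, ← Finset.sum_add_distrib]
      refine Finset.sum_le_sum fun k _ => ?_
      rw [← mul_add]
      refine mul_le_mul_of_nonneg_left ?_ (mul_nonneg (h1 i) (h1 k))
      simpa using hWC (s i) (s k)
    linarith
  set e := sSup S
  have heS : e ∈ S := hSclosed.csSup_mem hSne hSbdd
  obtain ⟨θ, κ, hθ, hθ2, hκ, hmass⟩ := exists_mass_above_mean hp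
  set a := e + κ / 2 with ha
  have ha0 : 0 ≤ a := by have := heS.1; positivity
  -- raising the value to `a` on a small set does not change the relaxed energy
  have hsmall : ∀ A, MeasurableSet A → 0 < μ.real A → μ.real A < θ * M →
      μ.real A ^ 2 * G (a, a) + 2 * μ.real A * (M - μ.real A) * G (a, 0) +
        (M - μ.real A) ^ 2 * Z = M ^ 2 * Z := by
    intro A hA hα0 hαθ
    set α := μ.real A with hα
    have hβ0 : 0 < M - α := by nlinarith
    obtain ⟨u, huA, huA', hGu⟩ := exists_twoValued (p := p) hΩ hA a 0
    have hGu' := hGu G hsym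
    rw [← hμ, hcompl A hA, ← hα] at hGu'
    apply le_antisymm
    · refine le_of_forall_pos_le_add fun ε hε => ?_
      -- `1 / 4` keeps the energy below `3 / 4`, `κ / 2` gives `a ≤ e - δ + κ`, and `ε / M ^ 2`
      -- bounds the energy error by `ε`.
      set δ := min (min (1 / 4) (κ / 2)) (ε / M ^ 2) with hδ
      have hδ0 : 0 < δ := by positivity
      have hδ1 : δ ≤ 1 / 4 := (min_le_left _ _).trans (min_le_left _ _)
      have hδ2 : δ ≤ κ / 2 := (min_le_left _ _).trans (min_le_right _ _)
      have hδ3 : M ^ 2 * δ ≤ ε := by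
        have := min_le_right (min (1 / 4) (κ / 2)) (ε / M ^ 2)
        rw [← hδ, le_div_iff₀ (by positivity)] at this
        linarith
      obtain ⟨ι, hι, s, P, h1, h2, h3, h4⟩ := hdlow e heS.2 δ hδ0
      obtain ⟨Q, hQ0, hQP, hQθ, hQm⟩ := hmass ι s P h1 h2 (by linarith)
      set T := ∑ i, Q i with hT
      have hT0 : 0 < T := lt_of_lt_of_le hθ hQθ
      -- As `α < θ * M ≤ T * M`, filling `A` with the normalised `Q` uses no more of any value than
      -- `M * P` supplies.
      have hαT : α / T ≤ M := by
        rw [div_le_iff₀ hT0]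
        nlinarith
      have hP'0 : ∀ i, 0 ≤ T⁻¹ * Q i := fun i => mul_nonneg (by positivity) (hQ0 i)
      have hP'1 : ∑ i, T⁻¹ * Q i = 1 := by rw [← Finset.mul_sum, ← hT, inv_mul_cancel₀ hT0.ne']
      have hR0 : ∀ i, 0 ≤ (M - α)⁻¹ * (M * P i - α * (T⁻¹ * Q i)) := by
        intro i
        refine mul_nonneg (by positivity) (sub_nonneg.2 ?_)
        calc α * (T⁻¹ * Q i) = α / T * Q i := by ring
          _ ≤ M * P i := mul_le_mul hαT (hQP i) (hQ0 i) hM0.le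
      have hR1 : ∑ i, (M - α)⁻¹ * (M * P i - α * (T⁻¹ * Q i)) = 1 := by
        rw [← Finset.mul_sum, Finset.sum_sub_distrib, ← Finset.mul_sum, ← Finset.mul_sum, hP'1, h2,
          mul_one, mul_one, inv_mul_cancel₀ hβ0.ne']
      have hbar : |a| ≤ ∑ i, T⁻¹ * Q i * |s i| := by
        simp only [mul_assoc]
        rw [abs_of_nonneg ha0, ← Finset.mul_sum, inv_mul_eq_div, le_div_iff₀ hT0]
        refine le_trans ?_ hQm
        refine mul_le_mul_of_nonneg_right ?_ hT0.le
        linarith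
      have h := weakRelaxation_le_finiteEnergy_of_abs_le hn hp hΩm hΩ hP'0 hP'1 hR0 hR1 s hA u
        hbar (b := 0) (by
          rw [abs_zero]
          exact Finset.sum_nonneg fun i _ => mul_nonneg (hR0 i) (abs_nonneg _)) huA huA'
      rw [hrel, hGu', EReal.coe_le_coe_iff, ← hμ, hcompl A hA, ← hα] at h
      -- The rearrangement preserves the total distribution, hence the energy.
      have hw : (fun i => T⁻¹ * Q i * α + (M - α)⁻¹ * (M * P i - α * (T⁻¹ * Q i)) * (M - α)) =
          fun i => M * P i := by
        funext i
        field_simp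
        ring
      rw [hw, finiteEnergy_const_mul] at h
      have : 0 < M ^ 2 := by positivity
      nlinarith
    · have := hglob u
      rwa [hGu', EReal.coe_le_coe_iff] at this
  obtain ⟨A, hA, hA0, hAlt⟩ := exists_small_measurableSet hn hΩ_ne hΩ_open (mul_pos hθ hM0)
  obtain ⟨B, hB, hB0, hBlt⟩ := exists_small_measurableSet hn hΩ_ne hΩ_open hA0
  have hqA := hsmall A hA hA0 hAlt
  have hqB := hsmall B hB hB0 (hBlt.trans hAlt)
  -- After division by the measure, the identity is affine in it; two distinct measures make both
  -- coefficients vanish.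
  have hq : G (a, a) = Z := by
    have h1 : μ.real A * (G (a, a) - 2 * G (a, 0) + Z) + 2 * M * (G (a, 0) - Z) = 0 :=
      mul_left_cancel₀ hA0.ne' (by linear_combination hqA)
    have h2 : μ.real B * (G (a, a) - 2 * G (a, 0) + Z) + 2 * M * (G (a, 0) - Z) = 0 :=
      mul_left_cancel₀ hB0.ne' (by linear_combination hqB)
    have h3 : G (a, a) - 2 * G (a, 0) + Z = 0 :=
      mul_left_cancel₀ (sub_pos.2 hBlt).ne' (by linear_combination h1 - h2)
    have h4 : G (a, 0) - Z = 0 :=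
      mul_left_cancel₀ hM0.ne' (by rw [h3] at h1; linarith)
    linarith
  have : a ≤ e := le_csSup hSbdd ⟨ha0, hq⟩
  linarith
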